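/- **Setting.** Let $U=(U_1,U_2,\dots)$ be a sequence of independent random variables, uniform on $[0,1]$, on a probability space $(\Omega,\mathcal F,\mathbb P)$. A set $\mathcal X\subseteq\mathbb R^d$ is *cubifiable* if $\mathcal X=\mathcal X_1\times\dots\times\mathcal X_d$ with measurable $\mathcal X_i\subseteq\mathbb R$ such that for each $i$ there is a strictly increasing $C^1$-diffeomorphism $\psi_i:\mathcal X_i\to(0,1)$, meaning here a strictly increasing bijection whose inverse $(0,1)\to\mathcal X_i\subseteq\mathbb R$ is continuously differentiable; $\mathcal D(\mathcal X)$ is the set of all maps $\psi(x)=(\psi_1(x_1),\dots,\psi_d(x_d))$ obtained in this way. Let $\mathcal P_b(\mathcal X)$ be the set of probability measures on $\mathcal X$ that have a continuous and bounded density with respect to Lebesgue measure, and let $$\widetilde{\mathcal P}_b(\mathcal X)=\{\pi\in\mathcal P_b(\mathcal X):\ \exists\,\psi\in\mathcal D(\mathcal X)\text{ such that the pushforward }\pi_\psi\text{ lies in }\mathcal P_b((0,1)^d)\}.$$ For $N\ge1$ let $\mathcal Z^N=\{(x,w)\in\mathcal X^N\times\mathbb R_+^N:\sum_{n=1}^N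 w^n=1\}$. A *resampling scheme* $\rho$ is given by measurable functions $a_N^n:[0,1]^{\mathbb N}\times\mathcal Z^N\to\{1,\dots,N\}$, $1\le n\le N$, $N\ge 1$, through $\rho(u,z)=\frac1N\sum_{n=1}^N\delta(x^{a_N^n(u,z)})$ for $z=(x,w)\in\mathcal Z^N$. Put $\#^n(u,z)=\mathrm{card}\{i:a_N^i(u,z)=n\}$ and $\Delta^n_{\rho,z}=\#^n(U,z)-Nw^n$. The scheme is *unbiased* if $\mathbb E[\Delta_{\rho,z}^n]=0$ for all $N\ge1$, $z\in\mathcal Z^N$ and $1\le n\le N$. For a set $\mathcal P_0$ of probability measures on $\mathcal X$, the scheme is *$\mathcal P_0$-consistent* if for every $\pi\in\mathcal P_0$ and every sequence of random variables $\zeta^N=(X^{n,N},W^{n,N})_{n=1}^N$ with values in $\mathcal Z^N$, $N\ge1$, such that $(\zeta^N)_{N\ge1}$ is independent of $U$ and $\sum_{n=1}^N W^{n,N}\delta(X^{n,N})$ converges weakly to $\pi$ almost surely, also $\rho(U,\zeta^N)$ converges weakly to $\pi$ almost surely. Random variables $(Z^n)_{n=1}^N$ are *negatively associated* if $\mathrm{Cov}(\varphi_1(Z^n,n\in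 I_1),\varphi_2(Z^n,n\in I_2))\le0$ for all disjoint $I_1,I_2\subseteq\{1,\dots,N\}$ and all coordinatewise non-decreasing $\varphi_k:\mathbb R^{|I_k|}\to\mathbb R$ for which the covariance is well defined. **Theorem.** Let $\mathcal X$ be a cubifiable set and let $\rho$ be an unbiased resampling scheme such that * (H1) for all $N\ge1$ and $z\in\mathcal Z^N$, the random variables $(\#^n(U,z))_{n=1}^N$ are negatively associated; * (H2) there is a sequence $(r_N)_{N\ge1}$ of non-negative real numbers with $r_N=o(N/\log N)$ such that, for all $N$ large enough, $\sup_{z\in\mathcal Z^N}\sum_{n=1}^N\mathbb E[(\Delta_{\rho,z}^n)^2]\le r_N N$, and such that $$\sum_{N=1}^\infty\ \sup_{z\in\mathcal Z^N}\mathbb P\Big(\max_{1\le n\le N}|\Delta^n_{\rho,z}|>r_N\Big)<+\infty.$$ Then $\rho$ is $\widetilde{\mathcal P}_b(\mathcal X)$-consistent. -/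

import Mathlib

open MeasureTheory ProbabilityTheory Filter Topology Asymptotics
open scoped NNReal ENNReal

noncomputable section

/-- The open hypercube `(0,1)^d`. -/
def openUnitCube (d : ℕ) : Set (Fin d → ℝ) :=
  Set.univ.pi fun _ => Set.Ioo (0 : ℝ) 1

/-- `ψ` restricts to a strictly increasing bijection from `S` onto `(0,1)` whose inverse is
continuously differentiable on `(0,1)`. Differentiability of `ψ` itself is not required: this is
the convention under which the result is stated, and it covers the diffeomorphisms that are `C¹`
in both directions. -/
structure IsIncreasingC1Diffeo (S : Set ℝ) (ψ : ℝ → ℝ) : Prop where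
  bijOn : Set.BijOn ψ S (Set.Ioo 0 1)
  strictMonoOn : StrictMonoOn ψ S
  inverse_c1 : ∃ φ : ℝ → ℝ, Set.InvOn φ ψ S (Set.Ioo 0 1) ∧ ContDiffOn ℝ 1 φ (Set.Ioo 0 1)

/-- `X = X₁ × ⋯ × X_d` with each `Xᵢ` measurable and diffeomorphic to `(0,1)` through a strictly
increasing map. -/
def Cubifiable {d : ℕ} (X : Set (Fin d → ℝ)) : Prop :=
  ∃ S : Fin d → Set ℝ, (∀ i, MeasurableSet (S i)) ∧ X = Set.univ.pi S ∧
    ∀ i, ∃ ψ : ℝ → ℝ, IsIncreasingC1Diffeo (S i) ψ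

/-- `𝒟(X)`: the maps `Ψ : X → (0,1)^d`, `Ψ(x) = (ψ₁(x₁), …, ψ_d(x_d))`, with the `ψᵢ` as in the
definition of a cubifiable set. -/
def cubifications {d : ℕ} (X : Set (Fin d → ℝ)) : Set (X → openUnitCube d) :=
  {Ψ | ∃ (S : Fin d → Set ℝ) (ψ : Fin d → ℝ → ℝ),
    (∀ i, MeasurableSet (S i)) ∧ X = Set.univ.pi S ∧
    (∀ i, IsIncreasingC1Diffeo (S i) (ψ i)) ∧
    ∀ (x : X) (i : Fin d), (Ψ x : Fin d → ℝ) i = ψ i ((x : Fin d → ℝ) i)}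

/-- `𝒫_b(X)`: probability measures on `X` with a continuous and bounded density with respect to
the Lebesgue measure on `X`. -/
def boundedDensityMeasures {d : ℕ} (X : Set (Fin d → ℝ)) : Set (Measure X) :=
  {μ | IsProbabilityMeasure μ ∧
    ∃ p : X → ℝ, Continuous p ∧ (∀ x, 0 ≤ p x) ∧ (∃ C : ℝ, ∀ x, p x ≤ C) ∧
      μ = (Measure.comap Subtype.val (volume : Measure (Fin d → ℝ))).withDensity fun x : X => ENNReal.ofReal (p x)}

/-- The set of `π ∈ 𝒫_b(X)` whose image under some `Ψ ∈ 𝒟(X)` lies in `𝒫_b((0,1)^d)`. -/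
def tildePb {d : ℕ} (X : Set (Fin d → ℝ)) : Set (ProbabilityMeasure X) :=
  {π | (π : Measure X) ∈ boundedDensityMeasures X ∧
    ∃ Ψ ∈ cubifications X, (π : Measure X).map Ψ ∈ boundedDensityMeasures (openUnitCube d)}

/-- `𝒵^N`: weighted point sets of size `N`, i.e. `N` points of `X` with `N` non-negative weights
of total mass one. There are none for `N = 0`. -/
abbrev WeightedPoints {d : ℕ} (X : Set (Fin d → ℝ)) (N : ℕ) : Type :=
  {z : (Fin N → X) × (Fin N → ℝ≥0) // ∑ n, z.2 n = 1}

namespace WeightedPoints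

variable {d N : ℕ} {X : Set (Fin d → ℝ)}

def point (z : WeightedPoints X N) (n : Fin N) : X := z.1.1 n

def weight (z : WeightedPoints X N) (n : Fin N) : ℝ≥0 := z.1.2 n

theorem size_ne_zero (z : WeightedPoints X N) : N ≠ 0 := by
  rintro rfl
  simpa using z.2

/-- The weighted empirical measure `∑ₙ wₙ δ(xₙ)`. -/
def empirical (z : WeightedPoints X N) : ProbabilityMeasure X :=
  ⟨∑ n, (z.weight n : ℝ≥0∞) • Measure.dirac (z.point n), ⟨by
    have h : ∑ n, (z.weight n : ℝ≥0∞) = 1 := by exact_mod_cast z.2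
    simpa using h⟩⟩

end WeightedPoints

/-- A resampling scheme: measurable functions `a_N^n : [0,1]^ℕ × 𝒵^N → {1, …, N}`. -/
structure ResamplingScheme {d : ℕ} (X : Set (Fin d → ℝ)) where
  index : ∀ N : ℕ, Fin N → (ℕ → unitInterval) → WeightedPoints X N → Fin N
  measurable_index : ∀ (N : ℕ) (n : Fin N),
    Measurable fun p : (ℕ → unitInterval) × WeightedPoints X N => index N n p.1 p.2

namespace ResamplingScheme

variable {d N : ℕ} {X : Set (Fin d → ℝ)} (ρ : ResamplingScheme X)

/-- The output `ρ(u, z) = N⁻¹ ∑ₙ δ(x^{a_N^n(u, z)})`. -/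
def resample (u : ℕ → unitInterval) (z : WeightedPoints X N) : ProbabilityMeasure X :=
  ⟨(N : ℝ≥0∞)⁻¹ • ∑ n, Measure.dirac (z.point (ρ.index N n u z)), ⟨by
    have h : (N : ℝ≥0∞) ≠ 0 := by exact_mod_cast z.size_ne_zero
    simpa using ENNReal.inv_mul_cancel h (ENNReal.natCast_ne_top N)⟩⟩

/-- The number of offspring of the `n`-th point. -/
def offspring (u : ℕ → unitInterval) (z : WeightedPoints X N) (n : Fin N) : ℕ :=
  (Finset.univ.filter fun i => ρ.index N i u z = n).card

/-- The deviation of the number of offspring of the `n`-th point from `N wₙ`. -/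
def deviation (u : ℕ → unitInterval) (z : WeightedPoints X N) (n : Fin N) : ℝ :=
  (ρ.offspring u z n : ℝ) - N * (z.weight n : ℝ)

variable {Ω : Type*} [MeasurableSpace Ω]

def IsUnbiased (P : Measure Ω) (U : Ω → ℕ → unitInterval) : Prop :=
  ∀ (N : ℕ) (z : WeightedPoints X N) (n : Fin N), ∫ ω, ρ.deviation (U ω) z n ∂P = 0

/-- `𝒫₀`-consistency. The inputs form an arbitrary sequence of random weighted point sets, jointly
independent of `U`; `ζ N` is the input of size `N + 1`, so that sizes run over `1, 2, …`. -/
def IsConsistent (P : Measure Ω) (U : Ω → ℕ → unitInterval)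
    (P₀ : Set (ProbabilityMeasure X)) : Prop :=
  ∀ π ∈ P₀, ∀ ζ : (N : ℕ) → Ω → WeightedPoints X (N + 1),
    (∀ N, Measurable (ζ N)) →
    IndepFun U (fun ω N => ζ N ω) P →
    (∀ᵐ ω ∂P, Tendsto (fun N => (ζ N ω).empirical) atTop (𝓝 π)) →
    ∀ᵐ ω ∂P, Tendsto (fun N => ρ.resample (U ω) (ζ N ω)) atTop (𝓝 π)

end ResamplingScheme

/-- `U` is a sequence of independent random variables, each uniform on `[0,1]`. -/
structure IsUniformSequence {Ω : Type*} [MeasurableSpace Ω] (P : Measure Ω)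
    (U : Ω → ℕ → unitInterval) : Prop where
  measurable : Measurable U
  indep : iIndepFun (fun i ω => U ω i) P
  uniform : ∀ i, P.map (fun ω => U ω i) = volume

/-- Negative association. The three integrability conditions say that the covariance is
well defined. -/
def NegativelyAssociated {Ω ι : Type*} [MeasurableSpace Ω] (P : Measure Ω)
    (Z : ι → Ω → ℝ) : Prop :=
  ∀ I₁ I₂ : Finset ι, Disjoint I₁ I₂ →
    ∀ (φ₁ : (I₁ → ℝ) → ℝ) (φ₂ : (I₂ → ℝ) → ℝ), Monotone φ₁ → Monotone φ₂ →
      Integrable (fun ω => φ₁ fun n => Z n ω) P →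
      Integrable (fun ω => φ₂ fun n => Z n ω) P →
      Integrable (fun ω => (φ₁ fun n => Z n ω) * φ₂ fun n => Z n ω) P →
      covariance (fun ω => φ₁ fun n => Z n ω) (fun ω => φ₂ fun n => Z n ω) P ≤ 0

end

theorem integrable_of_measurable_of_mem_Icc {Ω : Type*} [MeasurableSpace Ω] {P : Measure Ω}
    [IsFiniteMeasure P] {f : Ω → ℝ} (hf : Measurable f) {a b : ℝ} (h : ∀ ω, f ω ∈ Set.Icc a b) :
    Integrable f P :=
  Integrable.of_mem_Icc a b hf.aemeasurable (ae_of_all _ h)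

/-- For negatively associated variables, the expectation of a product of bounded non-negative
non-decreasing functions is at most the product of the expectations. -/
theorem NegativelyAssociated.integral_prod_le {Ω ι : Type*} [MeasurableSpace Ω] {P : Measure Ω}
    [IsProbabilityMeasure P] {Z : ι → Ω → ℝ} (hZ : NegativelyAssociated P Z)
    (hm : ∀ n, Measurable (Z n)) {g : ι → ℝ → ℝ} {C : ℝ} (hg : ∀ n, Monotone (g n))
    (hg0 : ∀ n x, 0 ≤ g n x) (hgC : ∀ n x, g n x ≤ C) (J : Finset ι) :
    ∫ ω, ∏ n ∈ J, g n (Z n ω) ∂P ≤ ∏ n ∈ J, ∫ ω, g n (Z n ω) ∂P := by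
  classical
  have hgm : ∀ n, Measurable fun ω => g n (Z n ω) := fun n => (hg n).measurable.comp (hm n)
  have hprod : ∀ K : Finset ι, MemLp (fun ω => ∏ n ∈ K, g n (Z n ω)) 2 P := fun K => by
    refine MemLp.of_bound (C := C ^ K.card)
      (Finset.measurable_fun_prod K fun n _ => hgm n).aestronglyMeasurable (ae_of_all _ fun ω => ?_)
    rw [Real.norm_of_nonneg (Finset.prod_nonneg fun n _ => hg0 n _)]
    exact (Finset.prod_le_prod (fun n _ => hg0 n _) fun n _ => hgC n _).trans_eq (by simp)
  induction J using Finset.induction_on with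
  | empty => simp
  | insert m J hmJ ih =>
    have hone : MemLp (fun ω => g m (Z m ω)) 2 P := by simpa using hprod {m}
    have hcov := hZ {m} J (Finset.disjoint_singleton_left.2 hmJ)
      (fun x => g m (x ⟨m, Finset.mem_singleton_self m⟩)) (fun x => ∏ n : J, g n (x n))
      (fun x y hxy => hg m (hxy _))
      (fun x y hxy => Finset.prod_le_prod (fun _ _ => hg0 _ _) fun n _ => hg n (hxy n))
    have hJ : ∀ ω, ∏ n : J, g n (Z n ω) = ∏ n ∈ J, g n (Z n ω) := fun ω =>
      Finset.prod_coe_sort J fun n => g n (Z n ω)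
    simp only [hJ] at hcov
    have hcov' := hcov (hone.integrable one_le_two) ((hprod J).integrable one_le_two)
      (hone.integrable_mul (hprod J))
    rw [covariance_eq_sub hone (hprod J)] at hcov'
    simp only [Finset.prod_insert hmJ]
    calc ∫ ω, g m (Z m ω) * ∏ n ∈ J, g n (Z n ω) ∂P
        ≤ (∫ ω, g m (Z m ω) ∂P) * ∫ ω, ∏ n ∈ J, g n (Z n ω) ∂P := by
          simpa using hcov'
      _ ≤ _ := mul_le_mul_of_nonneg_left ih (integral_nonneg fun ω => hg0 m _)

/-- Truncation of a real number to `[-r, r]`. -/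
noncomputable def truncate (r x : ℝ) : ℝ := max (-r) (min r x)

theorem monotone_truncate (r : ℝ) : Monotone (truncate r) := fun _ _ h =>
  max_le_max le_rfl (min_le_min le_rfl h)

theorem abs_truncate_le {r : ℝ} (hr : 0 ≤ r) (x : ℝ) : |truncate r x| ≤ r :=
  abs_le.2 ⟨le_max_left _ _, max_le (by linarith) (min_le_left _ _)⟩

theorem truncate_eq_self {r x : ℝ} (h : |x| ≤ r) : truncate r x = x := by
  rw [abs_le] at h
  rw [truncate, min_eq_right h.2, max_eq_right h.1]

theorem abs_truncate_le_abs {r : ℝ} (hr : 0 ≤ r) (x : ℝ) : |truncate r x| ≤ |x| := by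
  rcases le_total |x| r with h | h
  · rw [truncate_eq_self h]
  · exact (abs_truncate_le hr x).trans h

theorem truncate_sub_le_abs {r : ℝ} (hr : 0 ≤ r) (x : ℝ) : truncate r x - x ≤ |x| := by
  rcases le_total 0 x with h | h
  · have := (le_abs_self _).trans (abs_truncate_le_abs hr x)
    rw [abs_of_nonneg h] at *
    linarith
  · have : truncate r x ≤ 0 := max_le (by linarith) ((min_le_right _ _).trans h)
    rw [abs_of_nonpos h]
    linarith

theorem integral_exp_mul_le {Ω : Type*} [MeasurableSpace Ω] {P : Measure Ω}
    [IsProbabilityMeasure P] {D : Ω → ℝ} (hD : Measurable D) {r t : ℝ} (hDr : ∀ ω, |D ω| ≤ r)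
    (ht : 0 ≤ t) (htr : t * r ≤ 1) :
    ∫ ω, Real.exp (t * D ω) ∂P ≤ Real.exp (t * ∫ ω, D ω ∂P + t ^ 2 * ∫ ω, D ω ^ 2 ∂P) := by
  have hi : Integrable D P := integrable_of_measurable_of_mem_Icc hD fun ω => abs_le.1 (hDr ω)
  have hi2 : Integrable (fun ω => D ω ^ 2) P :=
    integrable_of_measurable_of_mem_Icc (hD.pow_const 2) (a := 0) (b := r ^ 2) fun ω =>
      ⟨sq_nonneg _, sq_le_sq' (abs_le.1 (hDr ω)).1 (abs_le.1 (hDr ω)).2⟩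
  have hb : ∀ ω, |t * D ω| ≤ 1 := fun ω => by
    rw [abs_mul, abs_of_nonneg ht]
    exact (mul_le_mul_of_nonneg_left (hDr ω) ht).trans htr
  have he : Integrable (fun ω => Real.exp (t * D ω)) P :=
    integrable_of_measurable_of_mem_Icc (hD.const_mul t).exp (a := 0) (b := Real.exp 1) fun ω =>
      ⟨(Real.exp_pos _).le, Real.exp_le_exp.2 ((le_abs_self _).trans (hb ω))⟩
  calc ∫ ω, Real.exp (t * D ω) ∂P ≤ ∫ ω, (1 + t * D ω + t ^ 2 * D ω ^ 2) ∂P := by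
        refine integral_mono he (((integrable_const _).add (hi.const_mul t)).add
          (hi2.const_mul _)) fun ω => ?_
        have := (abs_le.1 (Real.abs_exp_sub_one_sub_id_le (hb ω))).2
        simp only
        nlinarith
    _ = t * ∫ ω, D ω ∂P + t ^ 2 * ∫ ω, D ω ^ 2 ∂P + 1 := by
        have h1 : Integrable (fun ω => 1 + t * D ω) P := (integrable_const 1).add (hi.const_mul t)
        rw [integral_add h1 (hi2.const_mul _),
          integral_add (integrable_const 1) (hi.const_mul t), integral_const_mul,
          integral_const_mul]
        simp only [integral_const, probReal_univ, smul_eq_mul, mul_one]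
        ring
    _ ≤ _ := Real.add_one_le_exp _

/-- Chernoff bound for sums of truncated, recentred negatively associated variables. -/
theorem NegativelyAssociated.measureReal_sum_truncate_ge_le {Ω ι : Type*} [MeasurableSpace Ω]
    {P : Measure Ω} [IsProbabilityMeasure P] {Z : ι → Ω → ℝ} (hZ : NegativelyAssociated P Z)
    (hm : ∀ n, Measurable (Z n)) (c : ι → ℝ) {r t : ℝ} (hr : 0 ≤ r) (ht : 0 ≤ t)
    (htr : t * r ≤ 1) (J : Finset ι) (a : ℝ) :
    P.real {ω | a ≤ ∑ n ∈ J, truncate r (Z n ω - c n)} ≤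
      Real.exp (-t * a + t * ∑ n ∈ J, ∫ ω, truncate r (Z n ω - c n) ∂P +
        t ^ 2 * ∑ n ∈ J, ∫ ω, truncate r (Z n ω - c n) ^ 2 ∂P) := by
  have hD : ∀ n, Measurable fun ω => truncate r (Z n ω - c n) := fun n =>
    (monotone_truncate r).measurable.comp ((hm n).sub_const _)
  have hsum : Measurable fun ω => ∑ n ∈ J, truncate r (Z n ω - c n) :=
    Finset.measurable_fun_sum J fun n _ => hD n
  have hsumle : ∀ ω, |∑ n ∈ J, truncate r (Z n ω - c n)| ≤ J.card * r := fun ω => by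
    refine (Finset.abs_sum_le_sum_abs _ _).trans ?_
    simpa using Finset.sum_le_sum fun n (_ : n ∈ J) => abs_truncate_le hr (Z n ω - c n)
  have hint : Integrable (fun ω => Real.exp (t * ∑ n ∈ J, truncate r (Z n ω - c n))) P :=
    integrable_of_measurable_of_mem_Icc (hsum.const_mul t).exp (a := 0)
      (b := Real.exp (t * (J.card * r))) fun ω => ⟨(Real.exp_pos _).le, Real.exp_le_exp.2
        (mul_le_mul_of_nonneg_left ((le_abs_self _).trans (hsumle ω)) ht)⟩
  have hprod := hZ.integral_prod_le hm (g := fun n x => Real.exp (t * truncate r (x - c n)))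
    (C := Real.exp 1)
    (fun n x y hxy => Real.exp_le_exp.2
      (mul_le_mul_of_nonneg_left (monotone_truncate r (sub_le_sub_right hxy _)) ht))
    (fun n x => (Real.exp_pos _).le)
    (fun n x => Real.exp_le_exp.2 ((mul_le_mul_of_nonneg_left
      ((le_abs_self _).trans (abs_truncate_le hr _)) ht).trans htr)) J
  refine (measure_ge_le_exp_mul_mgf a ht hint).trans ?_
  rw [add_assoc, Real.exp_add]
  refine mul_le_mul_of_nonneg_left ?_ (Real.exp_pos _).le
  calc mgf (fun ω => ∑ n ∈ J, truncate r (Z n ω - c n)) P t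
      = ∫ ω, ∏ n ∈ J, Real.exp (t * truncate r (Z n ω - c n)) ∂P := by
        simp only [mgf, Finset.mul_sum, Real.exp_sum]
    _ ≤ _ := hprod
    _ ≤ ∏ n ∈ J, Real.exp (t * (∫ ω, truncate r (Z n ω - c n) ∂P) +
          t ^ 2 * ∫ ω, truncate r (Z n ω - c n) ^ 2 ∂P) :=
        Finset.prod_le_prod (fun n _ => integral_nonneg fun ω => (Real.exp_pos _).le) fun n _ =>
          integral_exp_mul_le (hD n) (fun ω => abs_truncate_le hr _) ht htr
    _ = _ := by rw [← Real.exp_sum, Finset.sum_add_distrib, Finset.mul_sum, Finset.mul_sum]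

/-- If `νs` converges weakly to `π` and, for the finite unions `B` of members of a topological
basis, `νs i B` is asymptotically at most `μs i B`, then `μs` converges weakly to `π`. -/
theorem tendsto_of_eventually_measure_biUnion_le {E : Type*} [TopologicalSpace E]
    [MeasurableSpace E] [OpensMeasurableSpace E] [HasOuterApproxClosed E]
    [SecondCountableTopology E] {S : Set (Set E)}
    (hS : TopologicalSpace.IsTopologicalBasis S) {π : ProbabilityMeasure E}
    {μs νs : ℕ → ProbabilityMeasure E} (hν : Tendsto νs atTop (𝓝 π))
    (h : ∀ T : Finset (Set E), (T : Set (Set E)) ⊆ S → ∀ j : ℕ, ∀ᶠ i in atTop,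
      (νs i : Measure E).real (⋃ t ∈ T, t) ≤
        (μs i : Measure E).real (⋃ t ∈ T, t) + 1 / ((j : ℝ) + 1)) :
    Tendsto μs atTop (𝓝 π) := by
  apply tendsto_of_forall_isOpen_le_liminf
  intro G hG
  refine (le_liminf_iff (isCoboundedUnder_ge_of_le (x := 1) atTop (by simp))
    (by isBoundedDefault)).2 fun s hs => ?_
  obtain ⟨T, hTS, hsT, hTG⟩ := π.exists_lt_measure_biUnion_of_isOpen (S := S)
    (fun u hu x hx => by
      obtain ⟨t, ht, hxt, htu⟩ := hS.exists_subset_of_mem_open hx hu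
      exact ⟨t, ht, (hS.isOpen ht).mem_nhds hxt, htu⟩) hG hs
  have hopen : IsOpen (⋃ t ∈ T, t) := isOpen_biUnion fun t ht => hS.isOpen (hTS t ht)
  obtain ⟨q, hsq, hqT⟩ := exists_between hsT
  have hlim := ProbabilityMeasure.le_liminf_measure_open_of_tendsto hν hopen
  have hev : ∀ᶠ i in atTop, (q : ℝ≥0∞) < (νs i : Measure E) (⋃ t ∈ T, t) := by
    refine eventually_lt_of_lt_liminf (lt_of_lt_of_le ?_ hlim)
    rw [← ProbabilityMeasure.ennreal_coeFn_eq_coeFn_toMeasure]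
    exact_mod_cast hqT
  obtain ⟨j, hj⟩ := exists_nat_one_div_lt (sub_pos.2 (NNReal.coe_lt_coe.2 hsq))
  filter_upwards [hev, h T hTS j] with i hi hi'
  have h1 : (q : ℝ) < (νs i : Measure E).real (⋃ t ∈ T, t) := by
    rw [← ProbabilityMeasure.ennreal_coeFn_eq_coeFn_toMeasure] at hi
    exact_mod_cast hi
  have h2 : (s : ℝ) < (μs i : Measure E).real (⋃ t ∈ T, t) := by linarith
  exact lt_of_lt_of_le (by exact_mod_cast h2) (ProbabilityMeasure.apply_mono _ hTG)

namespace ResamplingScheme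

variable {d N : ℕ} {X : Set (Fin d → ℝ)} (ρ : ResamplingScheme X)

theorem measurable_offspring (n : Fin N) :
    Measurable fun p : (ℕ → unitInterval) × WeightedPoints X N => (ρ.offspring p.1 p.2 n : ℝ) := by
  simp only [offspring, Finset.card_filter, Nat.cast_sum]
  refine Finset.measurable_fun_sum _ fun i _ => ?_
  exact (measurable_of_finite fun k : Fin N => (((if k = n then 1 else 0 : ℕ)) : ℝ)).comp
    (ρ.measurable_index N i)

theorem measurable_weight (n : Fin N) :
    Measurable fun z : WeightedPoints X N => (z.weight n : ℝ) :=
  ((measurable_pi_apply n).comp (measurable_snd.comp measurable_subtype_coe)).coe_nnreal_real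

theorem measurable_point (n : Fin N) : Measurable fun z : WeightedPoints X N => z.point n :=
  (measurable_pi_apply n).comp (measurable_fst.comp measurable_subtype_coe)

theorem measurable_deviation (n : Fin N) :
    Measurable fun p : (ℕ → unitInterval) × WeightedPoints X N => ρ.deviation p.1 p.2 n :=
  (ρ.measurable_offspring n).sub (((measurable_weight n).comp measurable_snd).const_mul _)

theorem sum_offspring (u : ℕ → unitInterval) (z : WeightedPoints X N) :
    ∑ n, ρ.offspring u z n = N := by
  simpa [offspring] using (Finset.card_eq_sum_card_fiberwise (s := Finset.univ)
    (t := Finset.univ) (f := fun i => ρ.index N i u z) (by simp)).symm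

theorem sum_weight (z : WeightedPoints X N) : ∑ n, (z.weight n : ℝ) = 1 := by
  exact_mod_cast z.2

theorem sum_abs_deviation_le (u : ℕ → unitInterval) (z : WeightedPoints X N) :
    ∑ n, |ρ.deviation u z n| ≤ 2 * N := by
  have h1 : ∑ n, (ρ.offspring u z n : ℝ) = N := by exact_mod_cast ρ.sum_offspring u z
  calc ∑ n, |ρ.deviation u z n| ≤ ∑ n, ((ρ.offspring u z n : ℝ) + N * (z.weight n : ℝ)) :=
        Finset.sum_le_sum fun n _ => (abs_sub _ _).trans_eq (by simp)
    _ = 2 * N := by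
        rw [Finset.sum_add_distrib, ← Finset.mul_sum, h1, sum_weight]
        ring

theorem abs_deviation_le (u : ℕ → unitInterval) (z : WeightedPoints X N) (n : Fin N) :
    |ρ.deviation u z n| ≤ 2 * N :=
  (Finset.single_le_sum (f := fun n => |ρ.deviation u z n|) (fun _ _ => abs_nonneg _)
    (Finset.mem_univ n)).trans (ρ.sum_abs_deviation_le u z)

theorem measureReal_empirical (z : WeightedPoints X N) {A : Set X} (hA : MeasurableSet A) :
    (z.empirical : Measure X).real A = ∑ n, A.indicator (fun _ => (z.weight n : ℝ)) (z.point n) := by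
  classical
  simp only [WeightedPoints.empirical, ProbabilityMeasure.coe_mk, Measure.real,
    Measure.finsetSum_apply, Measure.smul_apply, Measure.dirac_apply' _ hA, smul_eq_mul]
  rw [ENNReal.toReal_sum]
  · refine Finset.sum_congr rfl fun n _ => ?_
    by_cases h : z.point n ∈ A <;> simp [h]
  · intro n _
    by_cases h : z.point n ∈ A <;> simp [h]

theorem natCast_mul_measureReal_resample (u : ℕ → unitInterval) (z : WeightedPoints X N)
    {A : Set X} (hA : MeasurableSet A) :
    N * (ρ.resample u z : Measure X).real A =
      ∑ n, A.indicator (fun _ => (ρ.offspring u z n : ℝ)) (z.point n) := by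
  classical
  have hN : (N : ℝ) ≠ 0 := by exact_mod_cast z.size_ne_zero
  simp only [resample, ProbabilityMeasure.coe_mk, Measure.real, Measure.smul_apply,
    Measure.finsetSum_apply, Measure.dirac_apply' _ hA, smul_eq_mul, ENNReal.toReal_mul,
    ENNReal.toReal_inv, ENNReal.toReal_natCast]
  rw [mul_inv_cancel_left₀ hN, ENNReal.toReal_sum]
  · simp only [offspring, Finset.card_filter, Nat.cast_sum, Set.indicator_apply]
    simp only [← Finset.sum_filter]
    rw [Finset.sum_comm]
    refine Finset.sum_congr rfl fun i _ => ?_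
    by_cases h : z.point (ρ.index N i u z) ∈ A <;> simp [h]
  · intro n _
    by_cases h : z.point (ρ.index N n u z) ∈ A <;> simp [h]

theorem natCast_mul_measureReal_resample_sub (u : ℕ → unitInterval) (z : WeightedPoints X N)
    {A : Set X} (hA : MeasurableSet A) :
    N * ((ρ.resample u z : Measure X).real A - (z.empirical : Measure X).real A) =
      ∑ n, A.indicator (fun _ => ρ.deviation u z n) (z.point n) := by
  classical
  rw [mul_sub, ρ.natCast_mul_measureReal_resample u z hA, measureReal_empirical z hA,
    Finset.mul_sum, ← Finset.sum_sub_distrib]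
  refine Finset.sum_congr rfl fun n _ => ?_
  by_cases h : z.point n ∈ A <;> simp [h, deviation]

/-- The pairs `(u, z)` for which resampling increases the mass of `A` by more than `ε`. -/
def excess (N : ℕ) (A : Set X) (ε : ℝ) : Set ((ℕ → unitInterval) × WeightedPoints X N) :=
  {p | (p.2.empirical : Measure X).real A + ε < (ρ.resample p.1 p.2 : Measure X).real A}

theorem mem_excess_iff {A : Set X} (hA : MeasurableSet A) {ε : ℝ}
    (p : (ℕ → unitInterval) × WeightedPoints X N) :
    p ∈ ρ.excess N A ε ↔
      N * ε < ∑ n, A.indicator (fun _ => ρ.deviation p.1 p.2 n) (p.2.point n) := by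
  have hN : (0 : ℝ) < N := by exact_mod_cast Nat.pos_of_ne_zero p.2.size_ne_zero
  rw [← ρ.natCast_mul_measureReal_resample_sub p.1 p.2 hA, mul_lt_mul_iff_right₀ hN, excess,
    Set.mem_ofPred_eq, lt_sub_iff_add_lt']

theorem measurableSet_excess {A : Set X} (hA : MeasurableSet A) (ε : ℝ) :
    MeasurableSet (ρ.excess N A ε) := by
  classical
  have : ρ.excess N A ε =
      {p | N * ε < ∑ n, A.indicator (fun _ => ρ.deviation p.1 p.2 n) (p.2.point n)} :=
    Set.ext fun p => ρ.mem_excess_iff hA p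
  rw [this]
  refine measurableSet_lt measurable_const (Finset.measurable_fun_sum _ fun n _ => ?_)
  simp only [Set.indicator_apply]
  exact Measurable.ite (((measurable_point n).comp measurable_snd) hA) (ρ.measurable_deviation n)
    measurable_const

variable {Ω : Type*} [MeasurableSpace Ω] {P : Measure Ω} [IsProbabilityMeasure P]
  {U : Ω → ℕ → unitInterval} {ρ}

theorem measurable_deviation_comp (hU : Measurable U) (z : WeightedPoints X N) (n : Fin N) :
    Measurable fun ω => ρ.deviation (U ω) z n := by
  have h : Measurable fun ω => (U ω, z) := hU.prodMk measurable_const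
  simpa only [Function.comp_def] using (ρ.measurable_deviation n).comp h

theorem integrable_deviation (hU : Measurable U) (z : WeightedPoints X N) (n : Fin N) :
    Integrable (fun ω => ρ.deviation (U ω) z n) P :=
  integrable_of_measurable_of_mem_Icc (measurable_deviation_comp hU z n) fun ω =>
    abs_le.1 (ρ.abs_deviation_le (U ω) z n)

/-- Truncating the deviations at `r` biases their sum by at most `2N` times the probability that
some deviation exceeds `r`. -/
theorem sum_integral_truncate_deviation_le (hU : Measurable U) (hρ : ρ.IsUnbiased P U)
    (z : WeightedPoints X N) {r : ℝ} (hr : 0 ≤ r) (J : Finset (Fin N)) :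
    ∑ n ∈ J, ∫ ω, truncate r (ρ.deviation (U ω) z n) ∂P ≤
      2 * N * P.real {ω | ∃ n : Fin N, r < |ρ.deviation (U ω) z n|} := by
  set bad := {ω | ∃ n : Fin N, r < |ρ.deviation (U ω) z n|} with hbad
  have hmeas : MeasurableSet bad := by
    rw [hbad, Set.ofPred_exists]
    exact MeasurableSet.iUnion fun n =>
      measurableSet_lt measurable_const (measurable_deviation_comp hU z n).abs
  have htr : ∀ n, Integrable (fun ω => truncate r (ρ.deviation (U ω) z n)) P := fun n =>
    integrable_of_measurable_of_mem_Icc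
      ((monotone_truncate r).measurable.comp (measurable_deviation_comp hU z n)) fun ω =>
      abs_le.1 (abs_truncate_le hr _)
  have hsub : ∀ n ∈ J, Integrable
      (fun ω => truncate r (ρ.deviation (U ω) z n) - ρ.deviation (U ω) z n) P := fun n _ =>
    (htr n).sub (integrable_deviation hU z n)
  calc ∑ n ∈ J, ∫ ω, truncate r (ρ.deviation (U ω) z n) ∂P
      = ∫ ω, ∑ n ∈ J, (truncate r (ρ.deviation (U ω) z n) - ρ.deviation (U ω) z n) ∂P := by
        rw [integral_finsetSum J hsub]
        refine Finset.sum_congr rfl fun n _ => ?_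
        rw [integral_sub (htr n) (integrable_deviation hU z n), hρ N z n, sub_zero]
    _ ≤ ∫ ω, bad.indicator (fun _ => 2 * (N : ℝ)) ω ∂P := by
        refine integral_mono
          (integrable_finsetSum J hsub)
          ((integrable_const _).indicator hmeas) fun ω => ?_
        by_cases hω : ω ∈ bad
        · simp only [Set.indicator_of_mem hω]
          calc _ ≤ ∑ n ∈ J, |ρ.deviation (U ω) z n| :=
                Finset.sum_le_sum fun n _ => truncate_sub_le_abs hr _
            _ ≤ ∑ n, |ρ.deviation (U ω) z n| :=
                Finset.sum_le_sum_of_subset_of_nonneg J.subset_univ fun _ _ _ => abs_nonneg _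
            _ ≤ _ := ρ.sum_abs_deviation_le (U ω) z
        · have hle : ∀ n, |ρ.deviation (U ω) z n| ≤ r := by
            simpa [hbad] using hω
          simp [Set.indicator_of_notMem hω, truncate_eq_self (hle _)]
    _ = _ := by
        rw [integral_indicator_const _ hmeas, smul_eq_mul, mul_comm]

theorem sum_integral_sq_truncate_deviation_le (hU : Measurable U)
    (z : WeightedPoints X N) {r : ℝ} (hr : 0 ≤ r) (J : Finset (Fin N)) :
    ∑ n ∈ J, ∫ ω, truncate r (ρ.deviation (U ω) z n) ^ 2 ∂P ≤
      ∑ n, ∫ ω, ρ.deviation (U ω) z n ^ 2 ∂P := by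
  refine (Finset.sum_le_sum fun n _ => ?_).trans
    (Finset.sum_le_sum_of_subset_of_nonneg J.subset_univ fun n _ _ =>
      integral_nonneg fun ω => sq_nonneg _)
  refine integral_mono_of_nonneg (ae_of_all _ fun ω => sq_nonneg _) ?_
    (ae_of_all _ fun ω => sq_le_sq.2 (abs_truncate_le_abs hr _))
  exact integrable_of_measurable_of_mem_Icc ((measurable_deviation_comp hU z n).pow_const 2)
    (a := 0) (b := (2 * N) ^ 2) fun ω => ⟨sq_nonneg _,
      sq_le_sq' (abs_le.1 (ρ.abs_deviation_le _ z n)).1 (abs_le.1 (ρ.abs_deviation_le _ z n)).2⟩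

/-- Bernstein-type bound for the increase of the mass of `A`, for a fixed input. -/
theorem measure_excess_le (hU : Measurable U) (hρ : ρ.IsUnbiased P U) {z : WeightedPoints X N}
    (hz : NegativelyAssociated P fun (n : Fin N) ω => (ρ.offspring (U ω) z n : ℝ))
    {r t : ℝ} (hr : 0 ≤ r) (ht : 0 ≤ t) (htr : t * r ≤ 1)
    (hvar : ∑ n, ∫ ω, ρ.deviation (U ω) z n ^ 2 ∂P ≤ r * N)
    {A : Set X} (hA : MeasurableSet A) (ε : ℝ) :
    P {ω | (U ω, z) ∈ ρ.excess N A ε} ≤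
      P {ω | ∃ n : Fin N, r < |ρ.deviation (U ω) z n|} +
        ENNReal.ofReal (Real.exp (-t * (N * ε) +
          t * (2 * N * P.real {ω | ∃ n : Fin N, r < |ρ.deviation (U ω) z n|}) +
          t ^ 2 * (r * N))) := by
  classical
  set J : Finset (Fin N) := Finset.univ.filter fun n => z.point n ∈ A with hJ
  have hsub : {ω | (U ω, z) ∈ ρ.excess N A ε} ⊆
      {ω | ∃ n : Fin N, r < |ρ.deviation (U ω) z n|} ∪
        {ω | N * ε ≤ ∑ n ∈ J, truncate r (ρ.deviation (U ω) z n)} := by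
    intro ω hω
    by_cases hb : ∃ n : Fin N, r < |ρ.deviation (U ω) z n|
    · exact Or.inl hb
    · push Not at hb
      refine Or.inr ?_
      rw [Set.mem_ofPred_eq, ρ.mem_excess_iff hA] at hω
      simp only [Set.indicator_apply, ← Finset.sum_filter] at hω
      simpa only [Set.mem_ofPred_eq, truncate_eq_self (hb _)] using hω.le
  refine (measure_mono hsub).trans ((measure_union_le _ _).trans (add_le_add le_rfl ?_))
  rw [ENNReal.le_ofReal_iff_toReal_le (measure_ne_top _ _) (Real.exp_pos _).le]
  have hUz : Measurable fun ω => (U ω, z) := hU.prodMk measurable_const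
  have hm : ∀ n : Fin N, Measurable fun ω => (ρ.offspring (U ω) z n : ℝ) := fun n => by
    simpa only [Function.comp_def] using (ρ.measurable_offspring n).comp hUz
  have hch := hz.measureReal_sum_truncate_ge_le hm
    (fun n => N * (z.weight n : ℝ)) hr ht htr J (N * ε)
  refine hch.trans (Real.exp_le_exp.2 ?_)
  have h1 := sum_integral_truncate_deviation_le hU hρ z hr J
  have h2 := (sum_integral_sq_truncate_deviation_le (P := P) (ρ := ρ) hU z hr J).trans hvar
  exact add_le_add (add_le_add le_rfl (mul_le_mul_of_nonneg_left h1 ht))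
    (mul_le_mul_of_nonneg_left h2 (sq_nonneg t))

/-- Fubini: a bound for every fixed input passes to random inputs independent of `U`. -/
theorem measure_prodMk_mem_le {α β : Type*} [MeasurableSpace α] [MeasurableSpace β]
    {V : Ω → α} {Z : Ω → β} (hV : Measurable V) (hZ : Measurable Z) (hVZ : IndepFun V Z P)
    {B : Set (α × β)} (hB : MeasurableSet B) {b : ℝ≥0∞}
    (h : ∀ z, P {ω | (V ω, z) ∈ B} ≤ b) : P {ω | (V ω, Z ω) ∈ B} ≤ b := by
  have hmap := hVZ.map_prod_eq_prod_map_map hV.aemeasurable hZ.aemeasurable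
  have := Measure.isProbabilityMeasure_map (μ := P) hZ.aemeasurable
  have := Measure.isProbabilityMeasure_map (μ := P) hV.aemeasurable
  calc P {ω | (V ω, Z ω) ∈ B} = (P.map fun ω => (V ω, Z ω)) B :=
        (Measure.map_apply (hV.prodMk hZ) hB).symm
    _ = ∫⁻ z, P.map V ((fun x => (x, z)) ⁻¹' B) ∂P.map Z := by
        rw [hmap, Measure.prod_apply_symm hB]
    _ ≤ ∫⁻ _, b ∂P.map Z := lintegral_mono fun z => by
        rw [Measure.map_apply hV (measurable_prodMk_right hB)]
        exact h z
    _ = b := by simp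

end ResamplingScheme

theorem eventually_add_one_mul_log_le {r : ℕ → ℝ} (hr : ∀ N, 0 ≤ r N)
    (ho : r =o[atTop] fun N : ℕ => (N : ℝ) / Real.log N) {δ : ℝ} (hδ : 0 < δ) :
    ∀ᶠ N : ℕ in atTop, (r N + 1) * Real.log N ≤ δ * N := by
  have hlog := (Real.isLittleO_log_id_atTop.comp_tendsto tendsto_natCast_atTop_atTop).def
    (half_pos hδ)
  filter_upwards [ho.def (half_pos hδ), hlog, eventually_ge_atTop 2] with N h1 h2 hN
  have hN' : (1 : ℝ) < N := by exact_mod_cast hN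
  have hpos : 0 < Real.log N := Real.log_pos hN'
  have hq : 0 ≤ (N : ℝ) / Real.log N := by positivity
  rw [Real.norm_of_nonneg (hr N), Real.norm_of_nonneg hq] at h1
  simp only [Function.comp_apply, id_eq, Real.norm_of_nonneg hpos.le,
    Real.norm_of_nonneg (zero_le_one.trans hN'.le)] at h2
  have h3 : r N * Real.log N ≤ δ / 2 * N := by
    calc r N * Real.log N ≤ δ / 2 * (N / Real.log N) * Real.log N :=
          mul_le_mul_of_nonneg_right h1 hpos.le
      _ = δ / 2 * N := by field_simp
  linarith

theorem bernstein_exponent_le {n s ε c p ℓ : ℝ} (hn : 0 ≤ n) (hs : 0 < s) (hc : 0 ≤ c)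
    (hcε : c ≤ ε / 4) (hp : p ≤ ε / 4) (hℓ : s * ℓ ≤ c * ε / 8 * n) :
    -(c / s) * (n * ε) + c / s * (2 * n * p) + (c / s) ^ 2 * (s * n) ≤ -2 * ℓ := by
  have h1 : -(c / s) * (n * ε) + c / s * (2 * n * p) + (c / s) ^ 2 * (s * n) =
      c * n / s * (-ε + 2 * p + c) := by
    field_simp
  have h2 : c * n / s * (-ε + 2 * p + c) ≤ c * n / s * (-ε / 4) :=
    mul_le_mul_of_nonneg_left (by linarith) (by positivity)
  have h3 : ℓ ≤ c * ε / 8 * n / s := by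
    rw [le_div_iff₀ hs]
    linarith
  have h4 : c * n / s * (-ε / 4) = -2 * (c * ε / 8 * n / s) := by ring
  linarith

namespace ResamplingScheme

variable {d N : ℕ} {X : Set (Fin d → ℝ)} {ρ : ResamplingScheme X}
  {Ω : Type*} [MeasurableSpace Ω] {P : Measure Ω} [IsProbabilityMeasure P]
  {U : Ω → ℕ → unitInterval}

theorem eventually_measure_excess_le (hU : Measurable U) (hρ : ρ.IsUnbiased P U)
    (hna : ∀ (N : ℕ) (z : WeightedPoints X N),
      NegativelyAssociated P fun (n : Fin N) ω => (ρ.offspring (U ω) z n : ℝ))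
    {r : ℕ → ℝ} (hr : ∀ N, 0 ≤ r N) (ho : r =o[atTop] fun N : ℕ => (N : ℝ) / Real.log N)
    (hvar : ∀ᶠ N : ℕ in atTop, ∀ z : WeightedPoints X N,
      (∑ n, ∫ ω, (ρ.deviation (U ω) z n) ^ 2 ∂P) ≤ r N * N)
    {q : ℕ → ℝ≥0∞} (hq : Tendsto q atTop (𝓝 0))
    (hdev : ∀ (N : ℕ) (z : WeightedPoints X N),
      P {ω | ∃ n : Fin N, r N < |ρ.deviation (U ω) z n|} ≤ q N)
    {A : Set X} (hA : MeasurableSet A) {ε : ℝ} (hε : 0 < ε) :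
    ∀ᶠ N : ℕ in atTop, ∀ z : WeightedPoints X N,
      P {ω | (U ω, z) ∈ ρ.excess N A ε} ≤ q N + ENNReal.ofReal (1 / (N : ℝ) ^ 2) := by
  set c : ℝ := min (ε / 4) 1 with hc
  have hc0 : 0 < c := lt_min (by linarith) one_pos
  have hq' : ∀ᶠ N in atTop, q N ≤ ENNReal.ofReal (ε / 4) :=
    hq.eventually_le_const (ENNReal.ofReal_pos.2 (by linarith))
  filter_upwards [hvar, hq', eventually_gt_atTop 0,
    eventually_add_one_mul_log_le hr ho (δ := c * ε / 8) (by positivity)] with N hv hqN hN hl z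
  have hs : 0 < r N + 1 := by linarith [hr N]
  have hN' : (0 : ℝ) < N := by exact_mod_cast hN
  have hsub : P {ω | ∃ n : Fin N, r N + 1 < |ρ.deviation (U ω) z n|} ≤ q N :=
    (measure_mono (Set.ofPred_subset_ofPred.2 fun ω ⟨n, hn⟩ => ⟨n, by linarith⟩)).trans (hdev N z)
  have hp : P.real {ω | ∃ n : Fin N, r N + 1 < |ρ.deviation (U ω) z n|} ≤ ε / 4 :=
    ENNReal.toReal_le_of_le_ofReal (by linarith) (hsub.trans hqN)
  have hbound := measure_excess_le (t := c / (r N + 1)) hU hρ (hna N z) hs.le (by positivity)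
    (by rw [div_mul_cancel₀ _ hs.ne']; exact min_le_right _ _)
    ((hv z).trans (by nlinarith)) hA ε
  refine hbound.trans (add_le_add hsub (ENNReal.ofReal_le_ofReal ?_))
  refine (Real.exp_le_exp.2
    (bernstein_exponent_le hN'.le hs hc0.le (min_le_left _ _) hp hl)).trans_eq ?_
  rw [neg_mul, Real.exp_neg, two_mul, Real.exp_add, Real.exp_log hN', one_div, sq]

/-- Almost surely, resampling eventually increases the mass of `A` by at most `ε`. -/
theorem ae_eventually_resample_le (hU : Measurable U) {A : Set X} (hA : MeasurableSet A) {ε : ℝ}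
    {b : ℕ → ℝ≥0∞} (hb : ∑' N, b N ≠ ∞)
    (hexc : ∀ᶠ N : ℕ in atTop, ∀ z : WeightedPoints X N,
      P {ω | (U ω, z) ∈ ρ.excess N A ε} ≤ b N)
    {ζ : (N : ℕ) → Ω → WeightedPoints X (N + 1)} (hζ : ∀ N, Measurable (ζ N))
    (hind : IndepFun U (fun ω N => ζ N ω) P) :
    ∀ᵐ ω ∂P, ∀ᶠ N in atTop, (ρ.resample (U ω) (ζ N ω) : Measure X).real A ≤
      ((ζ N ω).empirical : Measure X).real A + ε := by
  obtain ⟨N₀, hN₀⟩ := eventually_atTop.1 hexc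
  have hle : ∀ N, P {ω | N₀ ≤ N ∧ (U ω, ζ N ω) ∈ ρ.excess (N + 1) A ε} ≤ b (N + 1) := fun N => by
    by_cases h : N₀ ≤ N
    · simp only [h, true_and]
      exact measure_prodMk_mem_le hU (hζ N) (hind.comp measurable_id (measurable_pi_apply N))
        (ρ.measurableSet_excess hA ε) (hN₀ (N + 1) (by omega))
    · simp [h]
  have hsum : ∑' N, P {ω | N₀ ≤ N ∧ (U ω, ζ N ω) ∈ ρ.excess (N + 1) A ε} ≠ ∞ :=
    ne_top_of_le_ne_top hb ((ENNReal.tsum_le_tsum hle).trans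
      (ENNReal.tsum_comp_le_tsum_of_injective (add_left_injective 1) b))
  filter_upwards [ae_eventually_notMem hsum] with ω hω
  filter_upwards [hω, eventually_ge_atTop N₀] with N hN hN'
  exact not_lt.1 fun hlt => hN ⟨hN', hlt⟩

end ResamplingScheme

theorem theorem1 {Ω : Type*} [MeasurableSpace Ω] (P : Measure Ω) [IsProbabilityMeasure P]
    (U : Ω → ℕ → unitInterval) (hU : IsUniformSequence P U)
    {d : ℕ} (X : Set (Fin d → ℝ)) (hX : Cubifiable X)
    (ρ : ResamplingScheme X) (hρ : ρ.IsUnbiased P U)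
    (H1 : ∀ (N : ℕ) (z : WeightedPoints X N),
      NegativelyAssociated P fun (n : Fin N) ω => (ρ.offspring (U ω) z n : ℝ))
    (H2 : ∃ r : ℕ → ℝ, (∀ N, 0 ≤ r N) ∧
      (r =o[atTop] fun N : ℕ => (N : ℝ) / Real.log N) ∧
      (∀ᶠ N : ℕ in atTop, ∀ z : WeightedPoints X N,
        (∑ n, ∫ ω, (ρ.deviation (U ω) z n) ^ 2 ∂P) ≤ r N * N) ∧
      (∑' N : ℕ, ⨆ z : WeightedPoints X N,
        P {ω | ∃ n : Fin N, r N < |ρ.deviation (U ω) z n|}) < ∞) :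
    ρ.IsConsistent P U (tildePb X) := by
  obtain ⟨r, hr, ho, hvar, hsum⟩ := H2
  set q : ℕ → ℝ≥0∞ := fun N => ⨆ z : WeightedPoints X N,
    P {ω | ∃ n : Fin N, r N < |ρ.deviation (U ω) z n|}
  intro π _ ζ hζ hind hlim
  have hqlim : Tendsto q atTop (𝓝 0) := ENNReal.tendsto_atTop_zero_of_tsum_ne_top hsum.ne
  have hb : ∑' N : ℕ, (q N + ENNReal.ofReal (1 / (N : ℝ) ^ 2)) ≠ ∞ := by
    rw [ENNReal.tsum_add]
    exact ENNReal.add_ne_top.2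
      ⟨hsum.ne, (Real.summable_one_div_nat_pow.2 one_lt_two).tsum_ofReal_ne_top⟩
  have hAe : ∀ (A : Set X), MeasurableSet A → ∀ j : ℕ, ∀ᵐ ω ∂P, ∀ᶠ N in atTop,
      (ρ.resample (U ω) (ζ N ω) : Measure X).real A ≤
        ((ζ N ω).empirical : Measure X).real A + 1 / ((j : ℝ) + 1) := fun A hA j =>
    ResamplingScheme.ae_eventually_resample_le hU.measurable hA hb
      (ResamplingScheme.eventually_measure_excess_le hU.measurable hρ H1 hr ho hvar hqlim
        (fun N z => le_iSup (fun z : WeightedPoints X N =>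
          P {ω | ∃ n : Fin N, r N < |ρ.deviation (U ω) z n|}) z) hA Nat.one_div_pos_of_nat) hζ hind
  have hS := TopologicalSpace.isBasis_countableBasis X
  have hTc : {T : Finset (Set X) |
      (T : Set (Set X)) ⊆ TopologicalSpace.countableBasis X}.Countable :=
    ((Set.countable_ofPred_finite_subset
      (TopologicalSpace.countable_countableBasis X)).preimage Finset.coe_injective).mono
      fun T hT => And.intro T.finite_toSet hT
  have hopen : ∀ T : Finset (Set X), (T : Set (Set X)) ⊆ TopologicalSpace.countableBasis X →
      MeasurableSet (⋃ t ∈ T, t) := fun T hT =>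
    (isOpen_biUnion fun t ht => hS.isOpen (hT ht)).measurableSet
  have hall : ∀ᵐ ω ∂P, ∀ T ∈ {T : Finset (Set X) |
      (T : Set (Set X)) ⊆ TopologicalSpace.countableBasis X}, ∀ j : ℕ, ∀ᶠ N in atTop,
      (ρ.resample (U ω) (ζ N ω) : Measure X).real (⋃ t ∈ T, t)ᶜ ≤
        ((ζ N ω).empirical : Measure X).real (⋃ t ∈ T, t)ᶜ + 1 / ((j : ℝ) + 1) :=
    (ae_ball_iff hTc).2 fun T hT => ae_all_iff.2 fun j => hAe _ (hopen T hT).compl j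
  filter_upwards [hall, hlim] with ω hω hω'
  refine tendsto_of_eventually_measure_biUnion_le hS hω' fun T hT j => ?_
  filter_upwards [hω T hT j] with N hN
  rw [probReal_compl_eq_one_sub (hopen T hT), probReal_compl_eq_one_sub (hopen T hT)] at hN
  linarith
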